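/- A $[k,n,1]$-graph is a $k$-partite graph with parts of order $n$ such that the bipartite graph induced by any pair of parts is a (not necessarily perfect) matching. An independent transversal of such a graph is an independent set that contains exactly one vertex of each part, and a factor of independent transversals is a set of pairwise disjoint independent transversals that cover all vertices. Let $f(k)$ be the smallest integer $n_0\ge 0$ such that, for every $n \ge n_0$, every $[k,n,1]$-graph has a factor of independent transversals. Theorem. For all sufficiently large $k$, $f(k)$ exists (i.e. some such $n_0$ exists) and $f(k) \le 1.78\,k$. -/

import Mathlib

/-- `G`, with its vertices distributed into the `k` parts `{v | part v = i}`, `i : Fin k`, is a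
`[k,n,1]`-graph: every part has exactly `n` vertices, no edge lies inside a part, and the bipartite
graph induced by any two parts is a (not necessarily perfect) matching, i.e. no vertex has two
distinct neighbours in the same part. -/
structure IsKNOneGraph {V : Type*} {k : ℕ} (G : SimpleGraph V) (part : V → Fin k) (n : ℕ) :
    Prop where
  encard_part : ∀ i : Fin k, {v : V | part v = i}.encard = n
  partite : ∀ u v : V, G.Adj u v → part u ≠ part v
  matching : ∀ u v w : V, G.Adj u v → G.Adj u w → part v = part w → v = w

/-- A transversal: a set of vertices containing exactly one vertex of each part. -/
def IsTransversal {V : Type*} {k : ℕ} (part : V → Fin k) (S : Set V) : Prop :=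
  ∀ i : Fin k, ∃! v : V, v ∈ S ∧ part v = i

/-- An independent transversal: a transversal that is an independent set of the graph. -/
def IsIndepTransversal {V : Type*} {k : ℕ} (G : SimpleGraph V) (part : V → Fin k) (S : Set V) :
    Prop :=
  IsTransversal part S ∧ G.IsIndepSet S

/-- There is a factor of independent transversals: a set of pairwise disjoint independent
transversals covering all vertices. -/
def HasIndepTransversalFactor {V : Type*} {k : ℕ} (G : SimpleGraph V) (part : V → Fin k) : Prop :=
  ∃ F : Set (Set V), (∀ S ∈ F, IsIndepTransversal G part S) ∧ F.PairwiseDisjoint id ∧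
    ⋃₀ F = Set.univ

/-- The set of all `n₀` such that, for all `n ≥ n₀`, every `[k,n,1]`-graph has a factor of
independent transversals. -/
def factorThresholds (k : ℕ) : Set ℕ :=
  {n₀ : ℕ | ∀ n : ℕ, n₀ ≤ n → ∀ (V : Type) (G : SimpleGraph V) (part : V → Fin k),
    IsKNOneGraph G part n → HasIndepTransversalFactor G part}

/-- `f(k)`: the least `n₀` such that, for all `n ≥ n₀`, every `[k,n,1]`-graph has a factor of
independent transversals. -/
noncomputable def leastFactorThreshold (k : ℕ) : ℕ :=
  sInf (factorThresholds k)

/-! Extend each matching to a permutation of `n` labels, which only adds constraints, and thread `n`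
disjoint independent transversals through the parts, one part at a time. A new part must avoid a
conflict relation that is a union of `|K|` permutations, `K` being the parts already used. By Hall,
failure means a conflict rectangle `A × B` with `|A| + |B| > n`. Both sides are at most `|K|`, so
the greedy choice works while `|K| ≤ n/2`.

To go further, the first `m ≈ n/4` parts are chosen so that almost every other part sees them
quasirandomly. Each uses a perfect matching drawn from a distribution with edge probabilities at
most about `1/(0.72 n)` (`exists_spread_weights`: Ore's condition, then Birkhoff). The deviations
from the means have small Schatten 4-norm on average (`exists_quasirandom_start`), so these parts
cover at most about `5/14` of any large rectangle. Each other part of `K` covers at most `min(|A|,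
|B|)` cells, and together they cannot fill the rectangle while `|K| < n/1.78`
(`exists_perm_not_conflict_of_quasirandom`). Only boundedly many parts are not quasirandom; they are
inserted right after the first `m`, where the greedy choice still works. -/

/-! ### Perfect matchings and regular subgraphs of dense bipartite graphs -/

open Finset in
/-- Hall's theorem in König's form: a relation on a finite type is avoided by some permutation
unless it contains a rectangle `A × B` with `|A| + |B| > |α|`. -/
theorem exists_perm_avoiding {α : Type*} [Fintype α] [DecidableEq α] (bad : α → α → Prop)
    (h : ∀ A B : Finset α, (∀ a ∈ A, ∀ b ∈ B, bad a b) → #A + #B ≤ Fintype.card α) :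
    ∃ π : Equiv.Perm α, ∀ a, ¬ bad a (π a) := by
  classical
  obtain ⟨f, hf, hg⟩ := (Finset.all_card_le_biUnion_card_iff_exists_injective
    (fun a : α ↦ univ.filter fun b ↦ ¬ bad a b)).1 (fun A ↦ by
      have h1 := h A (A.biUnion fun a ↦ univ.filter fun b ↦ ¬ bad a b)ᶜ (by
        intro a ha b hb
        simp only [mem_compl, mem_biUnion, mem_filter, mem_univ, true_and, not_exists, not_and,
          not_not] at hb
        exact hb a ha)
      rw [card_compl] at h1
      have h2 := card_le_univ (A.biUnion fun a ↦ univ.filter fun b ↦ ¬ bad a b)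
      omega)
  refine ⟨Equiv.ofBijective f (Finite.injective_iff_bijective.1 hf), fun a ↦ ?_⟩
  simpa using hg a

open Finset in
/-- A bipartite graph all of whose vertices have at most `d` non-neighbours, `2 d ≤ |α|`, has a
perfect matching. -/
theorem exists_perm_avoiding_of_degree_le {α : Type*} [Fintype α] [DecidableEq α]
    (bad : α → α → Prop) (d : ℕ) (hd : 2 * d ≤ Fintype.card α)
    (hl : ∀ a, ∀ B : Finset α, (∀ b ∈ B, bad a b) → #B ≤ d)
    (hr : ∀ b, ∀ A : Finset α, (∀ a ∈ A, bad a b) → #A ≤ d) :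
    ∃ π : Equiv.Perm α, ∀ a, ¬ bad a (π a) := by
  refine exists_perm_avoiding bad fun A B hAB ↦ ?_
  rcases A.eq_empty_or_nonempty with rfl | ⟨a, ha⟩
  · simpa using card_le_univ B
  rcases B.eq_empty_or_nonempty with rfl | ⟨b, hb⟩
  · simpa using card_le_univ A
  have h1 := hl a B (hAB a ha)
  have h2 := hr b A fun a ha ↦ hAB a ha b hb
  omega

open Finset in
/-- Ore's theorem: a sufficient condition for a bipartite graph to have a spanning `r`-regular
subgraph. -/
theorem exists_regular_subgraph {α : Type*} [Fintype α] [DecidableEq α] (E : Finset (α × α))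
    (r : ℕ) (hl : ∀ a, r ≤ #{e ∈ E | e.1 = a}) (hr : ∀ b, r ≤ #{e ∈ E | e.2 = b})
    (h : ∀ A B : Finset α, r * #A ≤ r * #B + #{e ∈ E | e.1 ∈ A ∧ e.2 ∉ B}) :
    ∃ F ⊆ E, (∀ a, #{e ∈ F | e.1 = a} = r) ∧ ∀ b, #{e ∈ F | e.2 = b} = r := by
  classical
  -- An auxiliary Hall problem. An edge is matched to itself (kept) or to one of the `deg a - r`
  -- dummies of its row (dropped); each of the `deg b - r` dummies of a column occupies the slot of
  -- an edge there, forcing it to be dropped. So rows keep at least `r` edges and columns at most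
  -- `r`.
  let nb : E ⊕ (Σ b : α, Fin (#{e ∈ E | e.2 = b} - r)) →
      Finset ((α × α) ⊕ (Σ a : α, Fin (#{e ∈ E | e.1 = a} - r))) := fun v ↦
    match v with
    | Sum.inl e => disjSum {e.1} (univ.filter fun c ↦ c.1 = e.1.1)
    | Sum.inr c => disjSum (E.filter fun e ↦ e.2 = c.1) ∅
  obtain ⟨f, hf, hnb⟩ := (Finset.all_card_le_biUnion_card_iff_exists_injective nb).1 (by
    intro s
    set S : Finset (α × α) := s.toLeft.image Subtype.val with hS
    set B : Finset α := s.toRight.image Sigma.fst with hB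
    set A : Finset α := S.image Prod.fst with hA
    have hs : #s ≤ #S + ∑ b ∈ B, (#{e ∈ E | e.2 = b} - r) := by
      rw [← card_toLeft_add_card_toRight (u := s), hS,
        card_image_of_injective _ Subtype.val_injective]
      gcongr
      calc #s.toRight ≤ #(B.sigma fun b ↦ (univ : Finset (Fin (#{e ∈ E | e.2 = b} - r)))) := by
            apply card_le_card
            intro c hc
            simp only [mem_sigma, mem_univ, and_true, hB]
            exact mem_image_of_mem _ hc
        _ = _ := by simp [card_sigma]
    have hsub : disjSum (S ∪ E.filter fun e ↦ e.2 ∈ B)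
        (A.sigma fun a ↦ (univ : Finset (Fin (#{e ∈ E | e.1 = a} - r)))) ⊆ s.biUnion nb := by
      intro v hv
      rw [mem_biUnion]
      rcases v with e | c
      · simp only [inl_mem_disjSum, mem_union, mem_filter] at hv
        rcases hv with hv | ⟨hv, hv'⟩
        · simp only [hS, mem_image, mem_toLeft] at hv
          obtain ⟨e', he', rfl⟩ := hv
          exact ⟨_, he', by simp [nb]⟩
        · simp only [hB, mem_image, mem_toRight] at hv'
          obtain ⟨c, hc, hce⟩ := hv'
          exact ⟨_, hc, by simp [nb, hv, hce]⟩
      · simp only [inr_mem_disjSum, mem_sigma, mem_univ, and_true, hA, hS, mem_image,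
          mem_toLeft] at hv
        obtain ⟨_, ⟨e', he', rfl⟩, hv⟩ := hv
        exact ⟨_, he', by simp [nb, hv]⟩
    have hN := card_le_card hsub
    rw [card_disjSum, card_sigma] at hN
    simp only [card_univ, Fintype.card_fin] at hN
    -- All edges of `S` lie in rows of `A`, so the edges of the columns `B` outside these rows are
    -- new.
    have hU : #S + #{e ∈ E | e.1 ∉ A ∧ e.2 ∈ B} ≤ #(S ∪ E.filter fun e ↦ e.2 ∈ B) := by
      rw [← card_union_of_disjoint]
      · apply card_le_card
        apply union_subset_union_right
        intro e
        simp +contextual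
      · rw [Finset.disjoint_left]
        intro e he he'
        simp only [mem_filter] at he'
        exact he'.2.1 (mem_image_of_mem _ he)
    have hsum1 : ∑ a ∈ A, #{e ∈ E | e.1 = a} = #{e ∈ E | e.1 ∈ A} := by
      rw [card_eq_sum_card_fiberwise (f := Prod.fst) (t := A) (by intro e; simp)]
      refine sum_congr rfl fun a ha ↦ ?_
      congr 1; ext e; grind
    have hsum2 : ∑ b ∈ B, #{e ∈ E | e.2 = b} = #{e ∈ E | e.2 ∈ B} := by
      rw [card_eq_sum_card_fiberwise (f := Prod.snd) (t := B) (by intro e; simp)]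
      refine sum_congr rfl fun a ha ↦ ?_
      congr 1; ext e; grind
    have h1 : ∑ a ∈ A, (#{e ∈ E | e.1 = a} - r) + r * #A = #{e ∈ E | e.1 ∈ A} := by
      rw [← hsum1, mul_comm, ← smul_eq_mul, ← sum_const, ← sum_add_distrib]
      exact sum_congr rfl fun a _ ↦ Nat.sub_add_cancel (hl a)
    have h2 : ∑ b ∈ B, (#{e ∈ E | e.2 = b} - r) + r * #B = #{e ∈ E | e.2 ∈ B} := by
      rw [← hsum2, mul_comm, ← smul_eq_mul, ← sum_const, ← sum_add_distrib]
      exact sum_congr rfl fun b _ ↦ Nat.sub_add_cancel (hr b)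
    have h3 : #{e ∈ E | e.1 ∈ A} = #{e ∈ E | e.1 ∈ A ∧ e.2 ∈ B} +
        #{e ∈ E | e.1 ∈ A ∧ e.2 ∉ B} := by
      rw [← card_filter_add_card_filter_not (s := E.filter fun e ↦ e.1 ∈ A) (fun e ↦ e.2 ∈ B),
        filter_filter, filter_filter]
    have h4 : #{e ∈ E | e.2 ∈ B} = #{e ∈ E | e.1 ∈ A ∧ e.2 ∈ B} +
        #{e ∈ E | e.1 ∉ A ∧ e.2 ∈ B} := by
      rw [← card_filter_add_card_filter_not (s := E.filter fun e ↦ e.2 ∈ B) (fun e ↦ e.1 ∈ A),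
        filter_filter, filter_filter]
      simp only [and_comm]
    have h5 := h A B
    omega)
  have hinl (e : E) : f (Sum.inl e) = Sum.inl e.1 ∨
      ∃ c, c.1 = e.1.1 ∧ f (Sum.inl e) = Sum.inr c := by
    have := hnb (Sum.inl e)
    rcases hfe : f (Sum.inl e) with e' | c
    · rw [hfe] at this; left; simpa [nb] using this
    · rw [hfe] at this; right; exact ⟨c, by simpa [nb] using this, rfl⟩
  have hinr (c) : ∃ e ∈ E, e.2 = c.1 ∧ f (Sum.inr c) = Sum.inl e := by
    have := hnb (Sum.inr c)
    rcases hfe : f (Sum.inr c) with e' | c'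
    · rw [hfe] at this
      simp only [nb, inl_mem_disjSum, mem_filter] at this
      exact ⟨e', this.1, this.2, rfl⟩
    · rw [hfe] at this; simp [nb] at this
  let F : Finset (α × α) := E.filter fun e ↦ ∃ he : e ∈ E, f (Sum.inl ⟨e, he⟩) = Sum.inl e
  have hFE : F ⊆ E := filter_subset _ _
  have hrow (a : α) : r ≤ #{e ∈ F | e.1 = a} := by
    have hle : #{e ∈ E \ F | e.1 = a} ≤ #{e ∈ E | e.1 = a} - r := by
      have := card_le_card_of_injOn (s := E.attach.filter fun e ↦ e.1 ∉ F ∧ e.1.1 = a)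
        (t := disjSum ∅ (univ.filter fun c : Σ a : α, Fin (#{e ∈ E | e.1 = a} - r) ↦ c.1 = a))
        (fun e ↦ f (Sum.inl e)) (by
          intro e he
          simp only [coe_filter, mem_attach, true_and, Set.mem_ofPred_eq] at he
          rcases hinl e with h1 | ⟨c, hc, h1⟩
          · exact absurd (mem_filter.2 ⟨e.2, e.2, h1⟩) he.1
          · simp only [mem_coe, h1, inr_mem_disjSum, mem_filter, mem_univ, true_and]
            exact hc.trans he.2)
        (fun e _ e' _ hee ↦ Sum.inl_injective (hf hee))
      rw [card_disjSum, card_empty, zero_add] at this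
      have hc : #(univ.filter fun c : Σ a : α, Fin (#{e ∈ E | e.1 = a} - r) ↦ c.1 = a) =
          #{e ∈ E | e.1 = a} - r := by
        have : (univ.filter fun c : Σ a : α, Fin (#{e ∈ E | e.1 = a} - r) ↦ c.1 = a) =
          ({a} : Finset α).sigma fun _ ↦ univ := by ext; simp
        rw [this, card_sigma]; simp
      rw [hc] at this
      refine le_trans ?_ this
      rw [← card_image_of_injective _ Subtype.val_injective]
      apply card_le_card
      intro e he
      simp only [mem_filter, mem_sdiff] at he
      exact mem_image.2 ⟨⟨e, he.1.1⟩, by simp [he.1.2, he.2], rfl⟩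
    have hsp : #{e ∈ E | e.1 = a} = #{e ∈ E \ F | e.1 = a} + #{e ∈ F | e.1 = a} := by
      rw [← card_union_of_disjoint, ← filter_union, sdiff_union_of_subset hFE]
      exact disjoint_filter_filter sdiff_disjoint
    have := hl a
    omega
  have hcol (b : α) : #{e ∈ F | e.2 = b} ≤ r := by
    choose g hgE hg2 hgf using hinr
    have hle : #{e ∈ E | e.2 = b} - r ≤ #{e ∈ E \ F | e.2 = b} := by
      have := card_le_card_of_injOn (s := (univ : Finset (Fin (#{e ∈ E | e.2 = b} - r))))
        (t := {e ∈ E \ F | e.2 = b}) (fun c ↦ g ⟨b, c⟩) (by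
          intro c _
          simp only [coe_filter, mem_sdiff, Set.mem_ofPred_eq]
          refine ⟨⟨hgE _, fun hc ↦ ?_⟩, hg2 _⟩
          obtain ⟨-, he, hfe⟩ := mem_filter.1 hc
          exact Sum.inl_ne_inr (hf (hfe.trans (hgf _).symm)))
        (fun c _ c' _ hcc ↦ by
          have h1 : f (Sum.inr ⟨b, c⟩) = f (Sum.inr ⟨b, c'⟩) := by
            rw [hgf, hgf]; exact congrArg _ hcc
          simpa using hf h1)
      simpa using this
    have hsp : #{e ∈ E | e.2 = b} = #{e ∈ E \ F | e.2 = b} + #{e ∈ F | e.2 = b} := by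
      rw [← card_union_of_disjoint, ← filter_union, sdiff_union_of_subset hFE]
      exact disjoint_filter_filter sdiff_disjoint
    have := hr b
    omega
  -- Both degree sums equal `|F|`, so the one-sided bounds are equalities.
  have htot1 : ∑ a, #{e ∈ F | e.1 = a} = #F :=
    (card_eq_sum_card_fiberwise (f := Prod.fst) (t := univ) (by intro e; simp)).symm
  have htot2 : ∑ b, #{e ∈ F | e.2 = b} = #F :=
    (card_eq_sum_card_fiberwise (f := Prod.snd) (t := univ) (by intro e; simp)).symm
  have hub : ∑ b, #{e ∈ F | e.2 = b} ≤ ∑ _b : α, r := sum_le_sum fun b _ ↦ hcol b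
  have hlb : ∑ _a : α, r ≤ ∑ a, #{e ∈ F | e.1 = a} := sum_le_sum fun a _ ↦ hrow a
  refine ⟨F, hFE, fun a ↦ ?_, fun b ↦ ?_⟩
  · exact ((sum_eq_sum_iff_of_le fun a _ ↦ hrow a).1 (by omega) a (mem_univ a)).symm
  · exact (sum_eq_sum_iff_of_le fun b _ ↦ hcol b).1 (by omega) b (mem_univ b)

open Finset in
/-- A spanning `r`-regular bipartite graph carries a probability distribution on its perfect
matchings in which every edge is used with probability at most `1 / r`. -/
theorem exists_weights_of_regular {α : Type*} [Fintype α] [DecidableEq α] (F : Finset (α × α))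
    (r : ℕ) (hr : 0 < r) (h1 : ∀ a, #{e ∈ F | e.1 = a} = r) (h2 : ∀ b, #{e ∈ F | e.2 = b} = r) :
    ∃ w : Equiv.Perm α → ℝ, (∀ π, 0 ≤ w π) ∧ ∑ π, w π = 1 ∧
      (∀ π, w π ≠ 0 → ∀ a, (a, π a) ∈ F) ∧
      ∀ a b, ∑ π, w π * (if π a = b then 1 else 0) ≤ 1 / (r : ℝ) := by
  have hr' : (0 : ℝ) < r := by exact_mod_cast hr
  -- The normalized biadjacency matrix is doubly stochastic; Birkhoff's decomposition gives the
  -- weights.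
  let M : Matrix α α ℝ := fun a b ↦ if (a, b) ∈ F then 1 / (r : ℝ) else 0
  have hM : M ∈ doublyStochastic ℝ α := by
    rw [mem_doublyStochastic_iff_sum]
    refine ⟨fun a b ↦ ?_, fun a ↦ ?_, fun b ↦ ?_⟩
    · simp only [M]; split_ifs <;> positivity
    · simp only [M]
      rw [← sum_filter, sum_const, nsmul_eq_mul]
      have : #{b | (a, b) ∈ F} = r := by
        rw [← h1 a]
        refine card_bij (fun b _ ↦ (a, b)) ?_ ?_ ?_
        · intro b; simp
        · intro b _ b' _; simp
        · rintro ⟨a', b'⟩ he; rw [mem_filter] at he; obtain ⟨he, rfl⟩ := he; simpa using he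
      rw [this]; field_simp
    · simp only [M]
      rw [← sum_filter, sum_const, nsmul_eq_mul]
      have : #{a | (a, b) ∈ F} = r := by
        rw [← h2 b]
        refine card_bij (fun a _ ↦ (a, b)) ?_ ?_ ?_
        · intro b; simp
        · intro b _ b' _; simp
        · rintro ⟨a', b'⟩ he; rw [mem_filter] at he; obtain ⟨he, rfl⟩ := he; simpa using he
      rw [this]; field_simp
  obtain ⟨w, hw0, hw1, hwM⟩ := exists_eq_sum_perm_of_mem_doublyStochastic hM
  have hent (a b : α) : ∑ π, w π * (if π a = b then 1 else 0) = M a b := by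
    rw [← hwM, Matrix.sum_apply]
    refine sum_congr rfl fun π _ ↦ ?_
    simp [Equiv.Perm.permMatrix, PEquiv.toMatrix_apply, eq_comm]
  refine ⟨w, hw0, hw1, fun π hπ a ↦ ?_, fun a b ↦ ?_⟩
  · by_contra hF
    have h0 := hent a (π a)
    simp only [M, if_neg hF] at h0
    have := (sum_eq_zero_iff_of_nonneg fun π' _ ↦
      mul_nonneg (hw0 π') (by split_ifs <;> norm_num)).1 h0 π (mem_univ _)
    simp at this
    exact hπ this
  · rw [hent]; simp only [M]; split_ifs
    · exact le_rfl
    · positivity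

open Finset in
/-- If every vertex of a balanced bipartite graph has at most `n / 4` non-neighbours, there is a
probability distribution on perfect matchings in which every edge has probability at most `1 / r`,
for every `r ≤ 0.72 n`. -/
theorem exists_spread_weights {α : Type*} [Fintype α] [DecidableEq α]
    (bad : α → α → Prop) (d r : ℕ) (hd : 4 * d ≤ Fintype.card α) (hr0 : 0 < r)
    (hr : 100 * r ≤ 72 * Fintype.card α)
    (hl : ∀ a, ∀ B : Finset α, (∀ b ∈ B, bad a b) → #B ≤ d)
    (hc : ∀ b, ∀ A : Finset α, (∀ a ∈ A, bad a b) → #A ≤ d) :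
    ∃ w : Equiv.Perm α → ℝ, (∀ π, 0 ≤ w π) ∧ ∑ π, w π = 1 ∧
      (∀ π, w π ≠ 0 → ∀ a, ¬ bad a (π a)) ∧
      ∀ a b, ∑ π, w π * (if π a = b then 1 else 0) ≤ 1 / (r : ℝ) := by
  classical
  set n := Fintype.card α with hn
  let E : Finset (α × α) := univ.filter fun e ↦ ¬ bad e.1 e.2
  have hrow (a : α) (B : Finset α) : #B ≤ #{b ∈ B | ¬ bad a b} + d := by
    have := card_filter_add_card_filter_not (s := B) (fun b ↦ bad a b)
    have := hl a (B.filter fun b ↦ bad a b) (by simp)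
    omega
  have hcol (b : α) (A : Finset α) : #A ≤ #{a ∈ A | ¬ bad a b} + d := by
    have := card_filter_add_card_filter_not (s := A) (fun a ↦ bad a b)
    have := hc b (A.filter fun a ↦ bad a b) (by simp)
    omega
  have hE1 (A B : Finset α) : #{e ∈ E | e.1 ∈ A ∧ e.2 ∈ B} = ∑ a ∈ A, #{b ∈ B | ¬ bad a b} := by
    rw [card_eq_sum_card_fiberwise (f := Prod.fst) (t := A) (by intro e; simp +contextual)]
    refine sum_congr rfl fun a ha ↦ ?_
    refine card_bij (fun e _ ↦ e.2) ?_ ?_ ?_ <;> simp +contextual [E, ha]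
    grind
  have hE2 (A B : Finset α) : #{e ∈ E | e.1 ∈ A ∧ e.2 ∈ B} = ∑ b ∈ B, #{a ∈ A | ¬ bad a b} := by
    rw [card_eq_sum_card_fiberwise (f := Prod.snd) (t := B) (by intro e; simp +contextual)]
    refine sum_congr rfl fun a ha ↦ ?_
    refine card_bij (fun e _ ↦ e.1) ?_ ?_ ?_ <;> simp +contextual [E, ha]
    grind
  have hb1 (A B : Finset α) : #A * #B ≤ #{e ∈ E | e.1 ∈ A ∧ e.2 ∈ B} + #A * d := by
    rw [hE1, ← smul_eq_mul, ← smul_eq_mul, ← sum_const, ← sum_const, ← sum_add_distrib]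
    exact sum_le_sum fun a _ ↦ hrow a B
  have hb2 (A B : Finset α) : #B * #A ≤ #{e ∈ E | e.1 ∈ A ∧ e.2 ∈ B} + #B * d := by
    rw [hE2, ← smul_eq_mul, ← smul_eq_mul, ← sum_const, ← sum_const, ← sum_add_distrib]
    exact sum_le_sum fun a _ ↦ hcol a A
  have hore (A B : Finset α) : r * #A + r * #B ≤ r * n + #{e ∈ E | e.1 ∈ A ∧ e.2 ∈ B} := by
    have h1 := hb1 A B
    have h2 := hb2 A B
    have ha : #A ≤ n := card_le_univ A
    have hb : #B ≤ n := card_le_univ B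
    generalize #{e ∈ E | e.1 ∈ A ∧ e.2 ∈ B} = e at *
    generalize #A = a at *
    generalize #B = b at *
    have key : ∀ a b : ℕ, a ≤ b → b ≤ n → a * b ≤ e + a * d → r * a + r * b ≤ r * n + e := by
      intro a b hab hbn h
      rcases le_total (a + b) n with hle | hle
      · nlinarith
      zify at *
      have hx : (72 * n - 100 * r : ℤ) * (a + b - n) ≥ 0 := mul_nonneg (by linarith) (by linarith)
      have hy : (a : ℤ) * (n - 4 * d) ≥ 0 := mul_nonneg (by positivity) (by linarith)
      -- With `x = a/n ≤ y = b/n`, this is `0.72 (x + y - 1) ≤ x y - x/4`, linear in `y`. For `x ≤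
      -- 0.72` the worst case is `y = 1`; otherwise it is `y = x`, where `x² - 1.69 x + 0.72` has
      -- negative discriminant. This is the limit on `r/n`.
      suffices 72 * (n : ℤ) * (a + b - n) ≤ 100 * a * b - 25 * a * n by nlinarith
      rcases le_total (100 * (a : ℤ)) (72 * n) with h3 | h3
      · nlinarith [mul_nonneg (sub_nonneg.2 h3) (sub_nonneg.2 hbn),
          mul_nonneg (Int.natCast_nonneg a) (Int.natCast_nonneg n)]
      · nlinarith [mul_nonneg (sub_nonneg.2 h3) (sub_nonneg.2 hab),
          sq_nonneg (200 * (a : ℤ) - 169 * n)]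
    rcases le_total a b with hab | hab
    · exact key a b hab hb h1
    · have := key b a hab ha h2
      omega
  have hrd : r + d ≤ n := by omega
  obtain ⟨F, hFE, hF1, hF2⟩ := exists_regular_subgraph E r
    (fun a ↦ by
      have h1 := hb1 {a} univ
      have h2 : #{e ∈ E | e.1 ∈ ({a} : Finset α) ∧ e.2 ∈ univ} = #{e ∈ E | e.1 = a} := by simp
      rw [h2] at h1
      simp only [card_singleton, one_mul, card_univ] at h1
      omega)
    (fun b ↦ by
      have h1 := hb2 univ {b}
      have h2 : #{e ∈ E | e.1 ∈ univ ∧ e.2 ∈ ({b} : Finset α)} = #{e ∈ E | e.2 = b} := by simp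
      rw [h2] at h1
      simp only [card_singleton, one_mul, card_univ] at h1
      omega)
    (fun A B ↦ by
      have h1 := hore A Bᶜ
      simp only [mem_compl] at h1
      have h2 : #B + #Bᶜ = n := card_add_card_compl B
      rw [← h2] at h1
      nlinarith)
  obtain ⟨w, hw0, hw1, hwF, hwr⟩ := exists_weights_of_regular F r hr0 hF1 hF2
  refine ⟨w, hw0, hw1, fun π hπ a ↦ ?_, hwr⟩
  have := hFE (hwF π hπ a)
  simpa [E] using this

/-! ### Frobenius and Schatten norms of sums of centred random matrices -/

/-- The sum of the squares of the entries of a real matrix. -/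
def sumSq {α : Type*} [Fintype α] (X : Matrix α α ℝ) : ℝ := ∑ a, ∑ b, X a b ^ 2

open Matrix in
theorem sumSq_eq_trace {α : Type*} [Fintype α] (X : Matrix α α ℝ) :
    sumSq X = (X * Xᵀ).trace := by
  simp [sumSq, Matrix.trace, Matrix.mul_apply, sq]

theorem sumSq_nonneg {α : Type*} [Fintype α] (X : Matrix α α ℝ) : 0 ≤ sumSq X :=
  Finset.sum_nonneg fun _ _ ↦ Finset.sum_nonneg fun _ _ ↦ sq_nonneg _

open Matrix in
theorem sumSq_transpose {α : Type*} [Fintype α] (X : Matrix α α ℝ) : sumSq Xᵀ = sumSq X := by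
  simp only [sumSq, Matrix.transpose_apply]
  exact Finset.sum_comm

theorem sumSq_add {α : Type*} [Fintype α] (X Y : Matrix α α ℝ) :
    sumSq (X + Y) = sumSq X + 2 * (∑ a, ∑ b, X a b * Y a b) + sumSq Y := by
  simp only [sumSq, Matrix.add_apply, Finset.mul_sum, ← Finset.sum_add_distrib]
  exact Finset.sum_congr rfl fun a _ ↦ Finset.sum_congr rfl fun b _ ↦ by ring

theorem sumSq_sub_le {α : Type*} [Fintype α] (X Y : Matrix α α ℝ) :
    sumSq (X - Y) ≤ 2 * sumSq X + 2 * sumSq Y := by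
  simp only [sumSq, Matrix.sub_apply, Finset.mul_sum, ← Finset.sum_add_distrib]
  exact Finset.sum_le_sum fun a _ ↦ Finset.sum_le_sum fun b _ ↦ by
    nlinarith [sq_nonneg (X a b + Y a b)]

theorem sumSq_add_add_le {α : Type*} [Fintype α] (X Y Z : Matrix α α ℝ) :
    sumSq (X + Y + Z) ≤ 3 * (sumSq X + sumSq Y + sumSq Z) := by
  simp only [sumSq, Matrix.add_apply, Finset.mul_sum, ← Finset.sum_add_distrib]
  exact Finset.sum_le_sum fun a _ ↦ Finset.sum_le_sum fun b _ ↦ by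
    nlinarith [sq_nonneg (X a b - Y a b), sq_nonneg (X a b - Z a b), sq_nonneg (Y a b - Z a b)]

/-- Convexity of `sumSq`. -/
theorem sumSq_sum_smul_le {α Ω : Type*} [Fintype α] [Fintype Ω] (w : Ω → ℝ) (hw : ∀ o, 0 ≤ w o)
    (hw1 : ∑ o, w o = 1) (X : Ω → Matrix α α ℝ) :
    sumSq (∑ o, w o • X o) ≤ ∑ o, w o * sumSq (X o) := by
  have h : ∑ o, w o * sumSq (X o) = ∑ a, ∑ b, ∑ o, w o * X o a b ^ 2 := by
    simp only [sumSq, Finset.mul_sum]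
    rw [Finset.sum_comm]
    exact Finset.sum_congr rfl fun a _ ↦ Finset.sum_comm
  rw [h]
  refine Finset.sum_le_sum fun a _ ↦ Finset.sum_le_sum fun b _ ↦ ?_
  have hc : ConvexOn ℝ Set.univ (fun x : ℝ ↦ x ^ 2) := Even.convexOn_pow even_two
  simpa [Matrix.sum_apply] using
    hc.map_sum_le (fun o _ ↦ hw o) hw1 (fun o _ ↦ Set.mem_univ (X o a b))

open Matrix in
/-- Left multiplication by the deviation of a random orthogonal matrix from its mean at most
doubles the Frobenius norm. -/
theorem sumSq_deviation_mul_le {α Ω : Type*} [Fintype α] [DecidableEq α] [Fintype Ω] (w : Ω → ℝ)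
    (hw : ∀ o, 0 ≤ w o) (hw1 : ∑ o, w o = 1) (M : Ω → Matrix α α ℝ)
    (hM : ∀ o, (M o)ᵀ * M o = 1) (o : Ω) (X : Matrix α α ℝ) :
    sumSq ((M o - ∑ o, w o • M o) * X) ≤ 4 * sumSq X := by
  have hMX (o : Ω) : sumSq (M o * X) = sumSq X := by
    rw [sumSq_eq_trace, sumSq_eq_trace, Matrix.transpose_mul, Matrix.trace_mul_comm,
      Matrix.mul_assoc, ← Matrix.mul_assoc _ (M o), hM, Matrix.one_mul, Matrix.trace_mul_comm]
  rw [Matrix.sub_mul, Matrix.sum_mul]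
  simp only [Matrix.smul_mul]
  have h1 := sumSq_sub_le (M o * X) (∑ o, w o • (M o * X))
  have h2 := sumSq_sum_smul_le w hw hw1 fun o ↦ M o * X
  simp only [hMX] at h1 h2
  rw [← Finset.sum_mul, hw1] at h2
  linarith

theorem sumSq_one {α : Type*} [Fintype α] [DecidableEq α] :
    sumSq (1 : Matrix α α ℝ) = Fintype.card α := by
  simp [sumSq_eq_trace]

theorem sum_weights_deviation {α Ω : Type*} [Fintype Ω] (w : Ω → ℝ)
    (hw1 : ∑ o, w o = 1) (M : Ω → Matrix α α ℝ) :
    ∑ o, w o • (M o - ∑ o, w o • M o) = 0 := by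
  simp only [smul_sub, Finset.sum_sub_distrib]
  rw [← Finset.sum_smul, hw1, one_smul, sub_self]

/-- If `L` has mean zero, the mean of the inner product of `L` with a fixed matrix vanishes. -/
theorem sum_weights_inner {α Ω : Type*} [Fintype α] [Fintype Ω] (w : Ω → ℝ)
    (K : Matrix α α ℝ) (L : Ω → Matrix α α ℝ) (hL : ∑ o, w o • L o = 0) :
    ∑ o, w o * (∑ a, ∑ b, K a b * L o a b) = 0 := by
  have h : ∑ o, w o * (∑ a, ∑ b, K a b * L o a b) =
      ∑ a, ∑ b, K a b * (∑ o, w o • L o) a b := by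
    simp only [Matrix.sum_apply, Matrix.smul_apply, Finset.mul_sum, smul_eq_mul]
    rw [Finset.sum_comm]
    refine Finset.sum_congr rfl fun a _ ↦ ?_
    rw [Finset.sum_comm]
    exact Finset.sum_congr rfl fun b _ ↦ Finset.sum_congr rfl fun o _ ↦ by ring
  rw [h, hL]
  simp

/-- Mean growth of the squared Frobenius norm under a centred random step. -/
theorem sum_weights_sumSq_add_le {α Ω : Type*} [Fintype α] [DecidableEq α] [Fintype Ω] (w : Ω → ℝ)
    (hw : ∀ o, 0 ≤ w o) (hw1 : ∑ o, w o = 1) (M : Ω → Matrix α α ℝ)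
    (hM : ∀ o, (M o).transpose * M o = 1) (S : Matrix α α ℝ) :
    ∑ o, w o * sumSq (S + (M o - ∑ o, w o • M o)) ≤ sumSq S + 4 * Fintype.card α := by
  set D : Ω → Matrix α α ℝ := fun o ↦ M o - ∑ o, w o • M o with hD
  have hDle (o : Ω) : sumSq (D o) ≤ 4 * Fintype.card α := by
    have := sumSq_deviation_mul_le w hw hw1 M hM o 1
    rwa [Matrix.mul_one, sumSq_one] at this
  have h0 := sum_weights_inner w S D (sum_weights_deviation w hw1 M)
  calc ∑ o, w o * sumSq (S + D o)
      = ∑ o, (w o * sumSq S + 2 * (w o * (∑ a, ∑ b, S a b * D o a b)) + w o * sumSq (D o)) :=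
        Finset.sum_congr rfl fun o _ ↦ by rw [sumSq_add]; ring
    _ = sumSq S + ∑ o, w o * sumSq (D o) := by
        rw [Finset.sum_add_distrib, Finset.sum_add_distrib, ← Finset.mul_sum, h0,
          ← Finset.sum_mul, hw1]; ring
    _ ≤ sumSq S + ∑ o, w o * (4 * Fintype.card α) := by
        gcongr with o
        · exact hw o
        · exact hDle o
    _ = _ := by rw [← Finset.sum_mul, hw1, one_mul]

open Matrix in
/-- Mean growth of the fourth power of the Schatten `4`-norm under a centred random step. -/
theorem sum_weights_sumSq_mul_transpose_le {α Ω : Type*} [Fintype α] [DecidableEq α] [Fintype Ω]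
    (w : Ω → ℝ) (hw : ∀ o, 0 ≤ w o) (hw1 : ∑ o, w o = 1) (M : Ω → Matrix α α ℝ)
    (hM : ∀ o, (M o)ᵀ * M o = 1) (hM' : ∀ o, M o * (M o)ᵀ = 1) (S : Matrix α α ℝ) :
    ∑ o, w o * sumSq ((S + (M o - ∑ o, w o • M o)) * (S + (M o - ∑ o, w o • M o))ᵀ) ≤
      sumSq (S * Sᵀ) + 32 * sumSq S + 48 * Fintype.card α := by
  set D : Ω → Matrix α α ℝ := fun o ↦ M o - ∑ o, w o • M o with hD
  have hDX (o : Ω) (X : Matrix α α ℝ) : sumSq (D o * X) ≤ 4 * sumSq X :=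
    sumSq_deviation_mul_le w hw hw1 M hM o X
  have hDT (o : Ω) (X : Matrix α α ℝ) : sumSq ((D o)ᵀ * X) ≤ 4 * sumSq X := by
    have h := sumSq_deviation_mul_le w hw hw1 (fun o ↦ (M o)ᵀ) (fun o ↦ by simpa using hM' o) o X
    convert h using 3
    simp [hD, Matrix.transpose_sum]
  have hDle (o : Ω) : sumSq (D o) ≤ 4 * Fintype.card α := by
    have := hDX o 1
    rwa [Matrix.mul_one, sumSq_one] at this
  have hD0 : ∑ o, w o • D o = 0 := sum_weights_deviation w hw1 M
  have hD0' : ∑ o, w o • (D o)ᵀ = 0 := by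
    rw [← Matrix.transpose_zero, ← hD0, Matrix.transpose_sum]; simp
  -- The terms linear in `D` average to zero.
  have h0 := sum_weights_inner w (S * Sᵀ) (fun o ↦ D o * Sᵀ + S * (D o)ᵀ) (by
    have h1 : ∑ o, w o • (D o * Sᵀ) = 0 := by
      simp only [← Matrix.smul_mul, ← Matrix.sum_mul, hD0, Matrix.zero_mul]
    have h2 : ∑ o, w o • (S * (D o)ᵀ) = 0 := by
      simp only [← Matrix.mul_smul, ← Matrix.mul_sum, hD0', Matrix.mul_zero]
    simp only [smul_add, Finset.sum_add_distrib, h1, h2, add_zero])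
  -- The square of the increment costs `3 (4 + 4) = 24` times `sumSq S` plus `48 n`. The
  -- second-order cross term is `2 ‖Dᵀ S‖² ≤ 8 sumSq S`, whence `32`.
  have hstep (o : Ω) : sumSq ((S + D o) * (S + D o)ᵀ) ≤ sumSq (S * Sᵀ) +
      2 * (∑ a, ∑ b, (S * Sᵀ) a b * (D o * Sᵀ + S * (D o)ᵀ) a b) +
      (32 * sumSq S + 48 * Fintype.card α) := by
    have e : (S + D o) * (S + D o)ᵀ = S * Sᵀ + (D o * Sᵀ + S * (D o)ᵀ + D o * (D o)ᵀ) := by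
      rw [Matrix.transpose_add]; noncomm_ring
    have h1 : sumSq (D o * Sᵀ + S * (D o)ᵀ + D o * (D o)ᵀ) ≤
        24 * sumSq S + 48 * Fintype.card α := by
      have h2 := hDX o Sᵀ
      have h3 : sumSq (S * (D o)ᵀ) = sumSq (D o * Sᵀ) := by
        rw [← sumSq_transpose]; simp
      have h4 := hDX o (D o)ᵀ
      rw [sumSq_transpose] at h2 h4
      have := hDle o
      have := sumSq_add_add_le (D o * Sᵀ) (S * (D o)ᵀ) (D o * (D o)ᵀ)
      linarith
    have h5 : ∑ a, ∑ b, (S * Sᵀ) a b * (D o * (D o)ᵀ) a b ≤ 4 * sumSq S := by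
      have h6 : ∑ a, ∑ b, (S * Sᵀ) a b * (D o * (D o)ᵀ) a b = sumSq ((D o)ᵀ * S) := by
        have : ∑ a, ∑ b, (S * Sᵀ) a b * (D o * (D o)ᵀ) a b =
            ((S * Sᵀ) * (D o * (D o)ᵀ)ᵀ).trace := by
          simp only [Matrix.trace, Matrix.diag_apply, Matrix.mul_apply (M := S * Sᵀ),
            Matrix.transpose_apply]
        rw [this, sumSq_eq_trace, Matrix.transpose_mul, Matrix.transpose_transpose,
          Matrix.transpose_mul, Matrix.transpose_transpose, Matrix.trace_mul_comm,
          Matrix.mul_assoc, Matrix.mul_assoc, Matrix.trace_mul_comm]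
        simp only [Matrix.mul_assoc]
      rw [h6]; exact hDT o S
    have h7 : ∑ a, ∑ b, (S * Sᵀ) a b * (D o * Sᵀ + S * (D o)ᵀ + D o * (D o)ᵀ) a b =
        ∑ a, ∑ b, (S * Sᵀ) a b * (D o * Sᵀ + S * (D o)ᵀ) a b +
        ∑ a, ∑ b, (S * Sᵀ) a b * (D o * (D o)ᵀ) a b := by
      simp only [← Finset.sum_add_distrib]
      exact Finset.sum_congr rfl fun a _ ↦ Finset.sum_congr rfl fun b _ ↦ by
        rw [Matrix.add_apply _ (D o * (D o)ᵀ)]; ring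
    rw [e, sumSq_add, h7]
    linarith
  calc ∑ o, w o * sumSq ((S + D o) * (S + D o)ᵀ)
      ≤ ∑ o, w o * (sumSq (S * Sᵀ) +
      2 * (∑ a, ∑ b, (S * Sᵀ) a b * (D o * Sᵀ + S * (D o)ᵀ) a b) +
      (32 * sumSq S + 48 * Fintype.card α)) :=
        Finset.sum_le_sum fun o _ ↦ mul_le_mul_of_nonneg_left (hstep o) (hw o)
    _ = ∑ o, (w o * (sumSq (S * Sᵀ) + (32 * sumSq S + 48 * Fintype.card α)) +
      2 * (w o * (∑ a, ∑ b, (S * Sᵀ) a b * (D o * Sᵀ + S * (D o)ᵀ) a b))) :=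
        Finset.sum_congr rfl fun o _ ↦ by ring
    _ = _ := by
        rw [Finset.sum_add_distrib, ← Finset.mul_sum, h0, ← Finset.sum_mul, hw1]; ring

open Matrix in
/-- The Schatten `4`-norm bounds the sum of the entries in a rectangle. -/
theorem sum_rectangle_pow_four_le {α : Type*} [Fintype α] (S : Matrix α α ℝ) (A B : Finset α) :
    (∑ a ∈ A, ∑ b ∈ B, S a b) ^ 4 ≤ (A.card : ℝ) ^ 2 * (B.card : ℝ) ^ 2 * sumSq (S * Sᵀ) := by
  set T := ∑ a ∈ A, ∑ a' ∈ A, (S * Sᵀ) a a' with hT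
  -- Cauchy–Schwarz over the columns here, and over `A × A` in the next step.
  have h1 : (∑ a ∈ A, ∑ b ∈ B, S a b) ^ 2 ≤ B.card * T := by
    have hcomm : ∑ a ∈ A, ∑ b ∈ B, S a b = ∑ b ∈ B, ∑ a ∈ A, S a b := Finset.sum_comm
    rw [hcomm]
    refine (sq_sum_le_card_mul_sum_sq (s := B)).trans ?_
    gcongr
    calc ∑ b ∈ B, (∑ a ∈ A, S a b) ^ 2 ≤ ∑ b, (∑ a ∈ A, S a b) ^ 2 :=
          Finset.sum_le_sum_of_subset_of_nonneg (Finset.subset_univ _) fun _ _ _ ↦ sq_nonneg _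
      _ = T := by
          simp only [hT, sq, Finset.sum_mul_sum, Matrix.mul_apply, Matrix.transpose_apply]
          rw [Finset.sum_comm]
          exact Finset.sum_congr rfl fun a _ ↦ Finset.sum_comm
  have h2 : T ^ 2 ≤ (A.card : ℝ) ^ 2 * sumSq (S * Sᵀ) := by
    have hprod : T = ∑ p ∈ A ×ˢ A, (S * Sᵀ) p.1 p.2 :=
      (Finset.sum_product' A A fun a b ↦ (S * Sᵀ) a b).symm
    rw [hprod]
    refine (sq_sum_le_card_mul_sum_sq (s := A ×ˢ A)).trans ?_
    rw [Finset.card_product, Nat.cast_mul, ← sq]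
    gcongr
    rw [Finset.sum_product' (s := A) (t := A) (f := fun a b ↦ (S * Sᵀ) a b ^ 2)]
    calc ∑ a ∈ A, ∑ b ∈ A, (S * Sᵀ) a b ^ 2 ≤ ∑ a ∈ A, ∑ b, (S * Sᵀ) a b ^ 2 :=
          Finset.sum_le_sum fun a _ ↦
            Finset.sum_le_sum_of_subset_of_nonneg (Finset.subset_univ _) fun _ _ _ ↦ sq_nonneg _
      _ ≤ sumSq (S * Sᵀ) :=
          Finset.sum_le_sum_of_subset_of_nonneg (Finset.subset_univ _) fun _ _ _ ↦
            Finset.sum_nonneg fun _ _ ↦ sq_nonneg _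
  calc (∑ a ∈ A, ∑ b ∈ B, S a b) ^ 4 = ((∑ a ∈ A, ∑ b ∈ B, S a b) ^ 2) ^ 2 := by ring
    _ ≤ (B.card * T) ^ 2 := by gcongr
    _ = (B.card : ℝ) ^ 2 * T ^ 2 := by ring
    _ ≤ (B.card : ℝ) ^ 2 * ((A.card : ℝ) ^ 2 * sumSq (S * Sᵀ)) := by gcongr
    _ = _ := by ring

/-! ### Extending partial transversals part by part -/

/-- The permutations `τ i`, `i ∈ I`, describe pairwise disjoint independent partial transversals:
the `t`-th one meets part `i` in `τ i t`, and `σ i j` is the matching between parts `i` and `j`. -/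
def CompatibleOn {P α : Type*} (σ : P → P → Equiv.Perm α) (τ : P → Equiv.Perm α)
    (I : Finset P) : Prop :=
  ∀ i ∈ I, ∀ j ∈ I, i ≠ j → ∀ t, σ i j (τ i t) ≠ τ j t

/-- The `t`-th partial transversal on the parts in `I` has a neighbour `x` in part `j`. -/
def Conflict {P α : Type*} (σ : P → P → Equiv.Perm α) (τ : P → Equiv.Perm α)
    (I : Finset P) (j : P) (t x : α) : Prop :=
  ∃ i ∈ I, σ i j (τ i t) = x

theorem card_le_of_conflict_left {P α : Type*} [DecidableEq α]
    {σ : P → P → Equiv.Perm α} {τ : P → Equiv.Perm α} {I : Finset P} {j : P} (t : α)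
    (B : Finset α) (h : ∀ x ∈ B, Conflict σ τ I j t x) : B.card ≤ I.card := by
  refine (Finset.card_le_card (t := I.image fun i ↦ σ i j (τ i t)) fun x hx ↦ ?_).trans
    Finset.card_image_le
  exact Finset.mem_image.2 (h x hx)

theorem card_le_of_conflict_right {P α : Type*} [DecidableEq α]
    {σ : P → P → Equiv.Perm α} {τ : P → Equiv.Perm α} {I : Finset P} {j : P} (x : α)
    (A : Finset α) (h : ∀ t ∈ A, Conflict σ τ I j t x) : A.card ≤ I.card := by
  refine (Finset.card_le_card (t := I.image fun i ↦ (τ i)⁻¹ ((σ i j)⁻¹ x)) fun t ht ↦ ?_).trans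
    Finset.card_image_le
  obtain ⟨i, hi, rfl⟩ := h t ht
  exact Finset.mem_image.2 ⟨i, hi, by simp⟩

theorem CompatibleOn.insert_update {P α : Type*} [DecidableEq P] {σ : P → P → Equiv.Perm α}
    (hσ : ∀ i j, σ j i = (σ i j)⁻¹) {τ : P → Equiv.Perm α} {I : Finset P}
    (h : CompatibleOn σ τ I) {j : P} (hj : j ∉ I) {π : Equiv.Perm α}
    (hπ : ∀ t, ¬ Conflict σ τ I j t (π t)) :
    CompatibleOn σ (Function.update τ j π) (insert j I) := by
  have hne {i : P} (hi : i ∈ I) : i ≠ j := fun h ↦ hj (h ▸ hi)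
  intro i hi i' hi' hii t
  rcases Finset.mem_insert.1 hi with rfl | hiI <;>
    rcases Finset.mem_insert.1 hi' with rfl | hiI'
  · exact absurd rfl hii
  · rw [Function.update_self, Function.update_of_ne (hne hiI'), hσ i' i]
    intro he
    exact hπ t ⟨i', hiI', by rw [← he]; simp⟩
  · rw [Function.update_self, Function.update_of_ne (hne hiI)]
    intro he
    exact hπ t ⟨i, hiI, he⟩
  · rw [Function.update_of_ne (hne hiI), Function.update_of_ne (hne hiI')]
    exact h i hiI i' hiI' hii t

/-- Adding the parts in `J` one by one, provided that each single step is possible. -/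
theorem CompatibleOn.exists_extension {P α : Type*} [DecidableEq P] {σ : P → P → Equiv.Perm α}
    (hσ : ∀ i j, σ j i = (σ i j)⁻¹) {τ : P → Equiv.Perm α} {I : Finset P}
    (h : CompatibleOn σ τ I) (J : Finset P) (hIJ : Disjoint I J)
    (hstep : ∀ j ∈ J, ∀ K τ', I ⊆ K → K ⊆ I ∪ J → j ∉ K → (∀ i ∈ I, τ' i = τ i) →
      ∃ π : Equiv.Perm α, ∀ t, ¬ Conflict σ τ' K j t (π t)) :
    ∃ τ', (∀ i ∈ I, τ' i = τ i) ∧ CompatibleOn σ τ' (I ∪ J) := by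
  induction J using Finset.induction_on with
  | empty => exact ⟨τ, fun _ _ ↦ rfl, by simpa using h⟩
  | insert j J hj ih =>
    rw [Finset.disjoint_insert_right] at hIJ
    obtain ⟨τ', hτ', hc⟩ := ih hIJ.2 fun i hi K τ' h1 h2 ↦
      hstep i (Finset.mem_insert_of_mem hi) K τ' h1
        (h2.trans (Finset.union_subset_union_right (Finset.subset_insert _ _)))
    have hjK : j ∉ I ∪ J := by simp [hj, hIJ.1]
    obtain ⟨π, hπ⟩ := hstep j (Finset.mem_insert_self _ _) (I ∪ J) τ' Finset.subset_union_left
      (Finset.union_subset_union_right (Finset.subset_insert _ _)) hjK hτ'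
    refine ⟨Function.update τ' j π, fun i hi ↦ ?_, ?_⟩
    · rw [Function.update_of_ne (fun h ↦ hIJ.1 (h ▸ hi) : i ≠ j), hτ' i hi]
    · rw [Finset.union_insert]
      exact hc.insert_update hσ hjK hπ

theorem exists_perm_not_conflict_of_card_le {P α : Type*} [Fintype α] [DecidableEq α]
    (σ : P → P → Equiv.Perm α) (τ : P → Equiv.Perm α) (I : Finset P) (j : P)
    (h : 2 * I.card ≤ Fintype.card α) : ∃ π : Equiv.Perm α, ∀ t, ¬ Conflict σ τ I j t (π t) :=
  exists_perm_avoiding_of_degree_le _ I.card h (fun t B ↦ card_le_of_conflict_left t B)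
    fun x A ↦ card_le_of_conflict_right x A

/-- Derandomization by averaging. The outcome must have nonzero weight, since only outcomes in the
support are known to avoid conflicts. -/
theorem exists_le_of_sum_weights_le {Ω : Type*} [Fintype Ω] (w f : Ω → ℝ) (C : ℝ)
    (hw : ∀ o, 0 ≤ w o) (hw1 : ∑ o, w o = 1) (h : ∑ o, w o * f o ≤ C) :
    ∃ o, w o ≠ 0 ∧ f o ≤ C := by
  by_contra! hc
  have hle : ∀ o ∈ Finset.univ, w o * C ≤ w o * f o := fun o _ ↦ by
    rcases eq_or_ne (w o) 0 with h0 | h0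
    · simp [h0]
    · exact mul_le_mul_of_nonneg_left (hc o h0).le (hw o)
  obtain ⟨o, -, ho⟩ : ∃ o ∈ Finset.univ, w o ≠ 0 := by
    by_contra! h0
    rw [Finset.sum_eq_zero h0] at hw1
    exact zero_ne_one hw1
  have := Finset.sum_lt_sum hle ⟨o, Finset.mem_univ o,
    mul_lt_mul_of_pos_left (hc o ho) (lt_of_le_of_ne (hw o) (Ne.symm ho))⟩
  rw [← Finset.sum_mul, hw1] at this
  linarith

/-! ### Quasirandom start and its use beyond `n/2` -/

/-- How far the union of the matchings from the parts in `I` to the part `j`, read as a relation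
between partial transversals and vertices, is from a prescribed matrix `E`. -/
noncomputable def discrepancy {P α : Type*} [DecidableEq α]
    (σ : P → P → Equiv.Perm α) (τ : P → Equiv.Perm α) (I : Finset P) (j : P)
    (E : Matrix α α ℝ) : Matrix α α ℝ :=
  ∑ i ∈ I, (σ i j * τ i).permMatrix ℝ - E

open Matrix in
/-- A derandomized choice of the first `m ≤ n / 4` parts: every later part sees them in a
quasirandom way. -/
theorem exists_quasirandom_start {P α : Type*} [Fintype P] [DecidableEq P] [Fintype α]
    [DecidableEq α] (σ : P → P → Equiv.Perm α) (hσ : ∀ i j, σ j i = (σ i j)⁻¹) (m r : ℕ)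
    (hm : 4 * m ≤ Fintype.card α) (hmP : m ≤ Fintype.card P) (hr0 : 0 < r)
    (hr : 100 * r ≤ 72 * Fintype.card α) :
    ∃ (I : Finset P) (τ : P → Equiv.Perm α) (E : P → Matrix α α ℝ), I.card = m ∧
      CompatibleOn σ τ I ∧ (∀ j a b, E j a b ≤ m * (1 / (r : ℝ))) ∧
      ∑ j, sumSq (discrepancy σ τ I j (E j) * (discrepancy σ τ I j (E j))ᵀ) ≤
        128 * (m : ℝ) ^ 2 * Fintype.card α * Fintype.card P := by
  set n := Fintype.card α with hn
  -- The potential adds `32 (m - i)` times the squared Frobenius norm, prepaying the growth of the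
  -- Schatten term over the remaining steps. Summing over all `j` lets one choice of `π` serve all
  -- parts.
  suffices H : ∀ i ≤ m, ∃ (I : Finset P) (τ : P → Equiv.Perm α) (E : P → Matrix α α ℝ),
      I.card = i ∧ CompatibleOn σ τ I ∧ (∀ j a b, E j a b ≤ i * (1 / (r : ℝ))) ∧
      ∑ j, (sumSq (discrepancy σ τ I j (E j) * (discrepancy σ τ I j (E j))ᵀ) +
        32 * ((m : ℝ) - i) * sumSq (discrepancy σ τ I j (E j))) ≤
        i * (128 * m * n * Fintype.card P) by
    obtain ⟨I, τ, E, h1, h2, h3, h4⟩ := H m le_rfl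
    refine ⟨I, τ, E, h1, h2, h3, ?_⟩
    simp only [sub_self, mul_zero, zero_mul, add_zero] at h4
    linarith
  intro i
  induction i with
  | zero =>
    intro _
    refine ⟨∅, fun _ ↦ 1, fun _ ↦ 0, rfl, by simp [CompatibleOn], by simp, ?_⟩
    simp [discrepancy, sumSq]
  | succ i ih =>
    intro him
    obtain ⟨I, τ, E, hI, hc, hE, hpot⟩ := ih (by omega)
    obtain ⟨p, hp⟩ : ∃ p, p ∉ I := by
      by_contra! h
      have := Finset.card_le_card (fun p _ ↦ h p : Finset.univ ⊆ I)
      rw [Finset.card_univ] at this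
      omega
    obtain ⟨w, hw0, hw1, hwc, hwr⟩ := exists_spread_weights (Conflict σ τ I p) i r (by omega) hr0 hr
      (fun t B h ↦ hI ▸ card_le_of_conflict_left t B h)
      (fun x A h ↦ hI ▸ card_le_of_conflict_right x A h)
    let M : P → Equiv.Perm α → Matrix α α ℝ := fun j π ↦ (σ p j * π).permMatrix ℝ
    have hM (j : P) (π : Equiv.Perm α) : (M j π)ᵀ * M j π = 1 := by
      simp only [M]
      rw [Matrix.transpose_permMatrix, ← Matrix.permMatrix_mul, mul_inv_cancel,
        Matrix.permMatrix_one]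
    have hM' (j : P) (π : Equiv.Perm α) : M j π * (M j π)ᵀ = 1 := by
      simp only [M]
      rw [Matrix.transpose_permMatrix, ← Matrix.permMatrix_mul, inv_mul_cancel,
        Matrix.permMatrix_one]
    let Q : P → Matrix α α ℝ := fun j ↦ ∑ π, w π • M j π
    -- The entry is the probability that `π a = (σ p j)⁻¹ b`.
    have hQ (j : P) (a b : α) : Q j a b ≤ 1 / (r : ℝ) := by
      refine le_of_eq_of_le ?_ (hwr a ((σ p j)⁻¹ b))
      simp only [Q, Matrix.sum_apply, Matrix.smul_apply, smul_eq_mul, M]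
      refine Finset.sum_congr rfl fun π _ ↦ ?_
      simp [Equiv.Perm.permMatrix, PEquiv.toMatrix_apply, Equiv.eq_symm_apply, eq_comm]
    let S : P → Matrix α α ℝ := fun j ↦ discrepancy σ τ I j (E j)
    have hmi : (0 : ℝ) ≤ m - (i + 1) := by
      have : ((i + 1 : ℕ) : ℝ) ≤ m := by exact_mod_cast him
      push_cast at this; linarith
    obtain ⟨π, hπ0, hπ⟩ := exists_le_of_sum_weights_le w
      (fun π ↦ ∑ j, (sumSq ((S j + (M j π - Q j)) * (S j + (M j π - Q j))ᵀ) +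
        32 * ((m : ℝ) - (i + 1)) * sumSq (S j + (M j π - Q j))))
      ((i + 1) * (128 * m * n * Fintype.card P)) hw0 hw1 (by
        have hj (j : P) : ∑ π, w π * (sumSq ((S j + (M j π - Q j)) * (S j + (M j π - Q j))ᵀ) +
            32 * ((m : ℝ) - (i + 1)) * sumSq (S j + (M j π - Q j))) ≤
            (sumSq (S j * (S j)ᵀ) + 32 * ((m : ℝ) - i) * sumSq (S j)) + 128 * m * n := by
          have h1 := sum_weights_sumSq_mul_transpose_le w hw0 hw1 (M j) (hM j) (hM' j) (S j)
          have h2 := mul_le_mul_of_nonneg_left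
            (sum_weights_sumSq_add_le w hw0 hw1 (M j) (hM j) (S j)) hmi
          simp only [mul_add, Finset.sum_add_distrib]
          have h3 : ∑ π, w π * (32 * ((m : ℝ) - (i + 1)) * sumSq (S j + (M j π - Q j))) =
              32 * (((m : ℝ) - (i + 1)) * ∑ π, w π * sumSq (S j + (M j π - Q j))) := by
            simp only [Finset.mul_sum]
            exact Finset.sum_congr rfl fun π _ ↦ by ring
          rw [h3]
          have h4 : (0 : ℝ) ≤ n := by positivity
          have h5 : (0 : ℝ) ≤ i := by positivity
          simp only [← hn] at h1 h2
          simp only [Q] at *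
          nlinarith [mul_nonneg h5 h4]
        simp only [Finset.mul_sum (s := Finset.univ (α := P))]
        rw [Finset.sum_comm]
        refine (Finset.sum_le_sum fun j _ ↦ hj j).trans ?_
        rw [Finset.sum_add_distrib, Finset.sum_const, Finset.card_univ, nsmul_eq_mul]
        have : ∑ j, (sumSq (S j * (S j)ᵀ) + 32 * ((m : ℝ) - i) * sumSq (S j)) ≤ _ := hpot
        linarith)
    refine ⟨insert p I, Function.update τ p π, fun j ↦ E j + Q j,
      by rw [Finset.card_insert_of_notMem hp, hI], hc.insert_update hσ hp (hwc π hπ0),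
      fun j a b ↦ ?_, ?_⟩
    · change E j a b + Q j a b ≤ _
      push_cast
      linarith [hE j a b, hQ j a b]
    · have hS (j : P) : discrepancy σ (Function.update τ p π) (insert p I) j (E j + Q j) =
          S j + (M j π - Q j) := by
        simp only [discrepancy, S, M]
        rw [Finset.sum_insert hp, Function.update_self,
          Finset.sum_congr rfl fun i hi ↦ by
            rw [Function.update_of_ne (fun h ↦ hp (h ▸ hi) : i ≠ p)]]
        abel
      simp only [hS]
      push_cast
      exact hπ

open Matrix in
/-- A part that sees the parts in `I` in a quasirandom way can be added to the parts in `K ⊇ I`. -/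
theorem exists_perm_not_conflict_of_quasirandom {P α : Type*} [DecidableEq P] [Fintype α]
    [DecidableEq α] (σ : P → P → Equiv.Perm α) (τ : P → Equiv.Perm α) (I K : Finset P) (hIK : I ⊆ K)
    (j : P) (E : Matrix α α ℝ) (hE : ∀ a b, E a b ≤ 5 / 14)
    (hS : sumSq (discrepancy σ τ I j E * (discrepancy σ τ I j E)ᵀ) ≤
      ((Fintype.card α : ℝ) / 200) ^ 4)
    (hn : 1000 ≤ Fintype.card α) (hK : 178 * (K.card + 1) ≤ 100 * Fintype.card α + 100)
    (hI : Fintype.card α ≤ 4 * I.card + 3) :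
    ∃ π : Equiv.Perm α, ∀ t, ¬ Conflict σ τ K j t (π t) := by
  refine exists_perm_avoiding _ fun A B hAB ↦ ?_
  set n := Fintype.card α with hn'
  by_contra! hlt
  have hA0 : A.Nonempty := by
    rw [Finset.nonempty_iff_ne_empty]; rintro rfl
    have := Finset.card_le_univ B
    simp at hlt; omega
  have hB0 : B.Nonempty := by
    rw [Finset.nonempty_iff_ne_empty]; rintro rfl
    have := Finset.card_le_univ A
    simp at hlt; omega
  obtain ⟨t₀, ht₀⟩ := hA0
  obtain ⟨x₀, hx₀⟩ := hB0
  have hBK : B.card ≤ K.card := card_le_of_conflict_left t₀ B (hAB t₀ ht₀)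
  have hAK : A.card ≤ K.card := card_le_of_conflict_right x₀ A fun t ht ↦ hAB t ht x₀ hx₀
  set S := discrepancy σ τ I j E with hSdef
  -- The number of cells of `A × B` covered by part `i`: at most one per row and one per column.
  let e : P → ℝ := fun i ↦ ∑ a ∈ A, ∑ b ∈ B, (σ i j * τ i).permMatrix ℝ a b
  have hentry (i : P) (a b : α) :
      (σ i j * τ i).permMatrix ℝ a b = if σ i j (τ i a) = b then 1 else 0 := by
    simp [Equiv.Perm.permMatrix, PEquiv.toMatrix_apply, eq_comm]
  have hnn (i : P) (a b : α) : 0 ≤ (σ i j * τ i).permMatrix ℝ a b := by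
    rw [hentry]; split_ifs <;> norm_num
  have heA (i : P) : e i ≤ A.card := by
    rw [← nsmul_one, ← Finset.sum_const]
    refine Finset.sum_le_sum fun a _ ↦ ?_
    simp only [hentry, Finset.sum_ite_eq]
    split_ifs <;> norm_num
  have heB (i : P) : e i ≤ B.card := by
    have hcomm : e i = ∑ b ∈ B, ∑ a ∈ A, (σ i j * τ i).permMatrix ℝ a b := Finset.sum_comm
    rw [hcomm, ← nsmul_one, ← Finset.sum_const]
    refine Finset.sum_le_sum fun b _ ↦ ?_
    have (a : α) : (σ i j (τ i a) = b) = (a = (τ i)⁻¹ ((σ i j)⁻¹ b)) := by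
      rw [Equiv.Perm.eq_inv_iff_eq, Equiv.Perm.eq_inv_iff_eq]
    simp only [hentry, this, Finset.sum_ite_eq']
    split_ifs <;> norm_num
  have hcover : (A.card : ℝ) * B.card ≤ ∑ i ∈ K, e i := by
    have h1 : ∑ i ∈ K, e i = ∑ a ∈ A, ∑ b ∈ B, ∑ i ∈ K, (σ i j * τ i).permMatrix ℝ a b := by
      simp only [e]
      rw [Finset.sum_comm]
      exact Finset.sum_congr rfl fun a _ ↦ Finset.sum_comm
    have h2 : (A.card : ℝ) * B.card = ∑ a ∈ A, ∑ b ∈ B, 1 := by simp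
    rw [h1, h2]
    refine Finset.sum_le_sum fun a ha ↦ Finset.sum_le_sum fun b hb ↦ ?_
    obtain ⟨i, hi, hib⟩ := hAB a ha b hb
    refine le_trans ?_ (Finset.single_le_sum (fun i _ ↦ hnn i a b) hi)
    rw [hentry, if_pos hib]
  have hIsum : ∑ i ∈ I, e i = ∑ a ∈ A, ∑ b ∈ B, S a b + ∑ a ∈ A, ∑ b ∈ B, E a b := by
    simp only [e]
    rw [Finset.sum_comm, ← Finset.sum_add_distrib]
    refine Finset.sum_congr rfl fun a _ ↦ ?_
    rw [Finset.sum_comm, ← Finset.sum_add_distrib]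
    refine Finset.sum_congr rfl fun b _ ↦ ?_
    rw [hSdef, discrepancy, Matrix.sub_apply, Matrix.sum_apply]
    ring
  have hEsum : ∑ a ∈ A, ∑ b ∈ B, E a b ≤ A.card * B.card * (5 / 14) := by
    calc ∑ a ∈ A, ∑ b ∈ B, E a b ≤ ∑ a ∈ A, ∑ b ∈ B, (5 / 14 : ℝ) :=
          Finset.sum_le_sum fun a _ ↦ Finset.sum_le_sum fun b _ ↦ hE a b
      _ = _ := by simp; ring
  set μ : ℝ := min (A.card : ℝ) B.card with hμ
  set ν : ℝ := max (A.card : ℝ) B.card with hν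
  have hμν : (A.card : ℝ) * B.card = μ * ν := (min_mul_max _ _).symm
  have hsum : μ + ν = A.card + B.card := min_add_max _ _
  have hK' : ∑ i ∈ K \ I, e i ≤ (K.card - I.card) * μ := by
    have h1 : ((K \ I).card : ℝ) = K.card - I.card := by
      rw [Finset.card_sdiff_of_subset hIK, Nat.cast_sub (Finset.card_le_card hIK)]
    rw [← h1, ← nsmul_eq_mul, ← Finset.sum_const]
    exact Finset.sum_le_sum fun i _ ↦ le_min (heA i) (heB i)
  rw [← Finset.sum_sdiff hIK, hIsum] at hcover
  have hn1 : (1000 : ℝ) ≤ n := by exact_mod_cast hn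
  have hKr : 178 * ((K.card : ℝ) + 1) ≤ 100 * n + 100 := by exact_mod_cast hK
  have hIr : (n : ℝ) ≤ 4 * I.card + 3 := by exact_mod_cast hI
  have hltr : (n : ℝ) + 1 ≤ A.card + B.card := by exact_mod_cast hlt
  have hνK : ν ≤ K.card := max_le (by exact_mod_cast hAK) (by exact_mod_cast hBK)
  have hνn : ν ≤ n := by linarith
  have hμn : (n : ℝ) ≤ 5 / 2 * μ := by linarith
  have hμ0 : 0 < μ := by linarith
  have hμν' : μ ≤ ν := min_le_max
  -- Since `ν ≤ n ≤ 5/2 μ`, the fourth root of the bound is at most `√2.5 / 200 · n μ`, and `√2.5 /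
  -- 200 < 0.008`.
  have hrect : ∑ a ∈ A, ∑ b ∈ B, S a b ≤ 8 / 1000 * n * μ := by
    refine le_of_pow_le_pow_left₀ (n := 4) (by norm_num) (by positivity) ?_
    calc (∑ a ∈ A, ∑ b ∈ B, S a b) ^ 4
        ≤ (A.card : ℝ) ^ 2 * (B.card : ℝ) ^ 2 * sumSq (S * Sᵀ) := sum_rectangle_pow_four_le S A B
      _ ≤ (A.card : ℝ) ^ 2 * (B.card : ℝ) ^ 2 * (n / 200 : ℝ) ^ 4 := by gcongr
      _ = μ ^ 2 * ν ^ 2 * (n / 200 : ℝ) ^ 4 := by rw [← mul_pow, hμν, mul_pow]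
      _ ≤ μ ^ 2 * (5 / 2 * μ) ^ 2 * (n / 200 : ℝ) ^ 4 := by
          gcongr
          linarith
      _ = (5 / 2) ^ 2 / 200 ^ 4 * (n * μ) ^ 4 := by ring
      _ ≤ (8 / 1000) ^ 4 * (n * μ) ^ 4 := by gcongr; norm_num
      _ = _ := by ring
  rw [hμν] at hcover hEsum
  -- Dividing by `μ` and using `ν > n/2`, the left side needs `9/14 ν > 0.3214 n`, while the rest is
  -- about `(1/1.78 - 1/4 + 0.008) n < 0.3199 n`.
  have hfin : μ * ν ≤ μ * ((K.card - I.card) + 8 / 1000 * n + 5 / 14 * ν) := by linarith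
  have := le_of_mul_le_mul_left hfin hμ0
  linarith

/-! ### Assembling the transversals -/

open Matrix in
/-- The permutation form of the theorem: permutations `σ i j` of an `n`-element set, indexed by pairs
of parts, can be made derangements by relabelling the parts. -/
theorem exists_compatible {P α : Type*} [Fintype P] [DecidableEq P] [Fintype α] [DecidableEq α]
    (σ : P → P → Equiv.Perm α) (hσ : ∀ i j, σ j i = (σ i j)⁻¹)
    (hn : 10 ^ 11 ≤ Fintype.card α) (hk : 178 * Fintype.card P ≤ 100 * Fintype.card α + 100) :
    ∃ τ : P → Equiv.Perm α, CompatibleOn σ τ Finset.univ := by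
  set n := Fintype.card α with hn'
  set k := Fintype.card P with hk'
  have hbase : CompatibleOn σ (fun _ ↦ 1) ∅ := by simp [CompatibleOn]
  rcases le_or_gt (2 * k) n with hkn | hkn
  · obtain ⟨τ, -, hτ⟩ := hbase.exists_extension hσ Finset.univ (Finset.disjoint_empty_left _)
      fun j _ K τ' _ _ _ _ ↦ exists_perm_not_conflict_of_card_le σ τ' K j (by
        have := Finset.card_le_univ K
        omega)
    exact ⟨τ, by simpa using hτ⟩
  obtain ⟨I, τ, E, hI, hc, hE, hpot⟩ := exists_quasirandom_start σ hσ (n / 4) (72 * n / 100)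
    (by omega) (by omega) (by omega) (by omega)
  rw [← hn', ← hk'] at hpot
  have hn1 : (10 ^ 11 : ℝ) ≤ n := by exact_mod_cast hn
  have hm4 : 4 * ((n / 4 : ℕ) : ℝ) ≤ n := by
    have : 4 * (n / 4) ≤ n := by omega
    exact_mod_cast this
  have hr7 : 7 * (n : ℝ) ≤ 10 * ((72 * n / 100 : ℕ) : ℝ) := by
    have : 7 * n ≤ 10 * (72 * n / 100) := by omega
    exact_mod_cast this
  -- `(1/4) / (7/10) = 5/14`; rounding `0.72 n` down leaves at least `0.7 n`.
  have hE' (j : P) (a b : α) : E j a b ≤ 5 / 14 := by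
    refine (hE j a b).trans ?_
    rw [mul_one_div, div_le_iff₀ (by linarith)]
    linarith
  let F : P → ℝ := fun j ↦ sumSq (discrepancy σ τ I j (E j) * (discrepancy σ τ I j (E j))ᵀ)
  let J : Finset P := Finset.univ.filter fun j ↦ j ∉ I ∧ ((n : ℝ) / 200) ^ 4 < F j
  have hkn' : (k : ℝ) ≤ n := by
    have : k ≤ n := by omega
    exact_mod_cast this
  -- Markov's inequality bounds `|J|` by the constant `8 · 200⁴ < 10¹¹ / 4`.
  have hJ : 4 * J.card ≤ n := by
    have h1 : J.card * ((n : ℝ) / 200) ^ 4 ≤ 128 * ((n / 4 : ℕ) : ℝ) ^ 2 * n * k := by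
      refine le_trans ?_ hpot
      rw [← nsmul_eq_mul, ← Finset.sum_const]
      calc ∑ j ∈ J, ((n : ℝ) / 200) ^ 4 ≤ ∑ j ∈ J, F j :=
            Finset.sum_le_sum fun j hj ↦ (Finset.mem_filter.1 hj).2.2.le
        _ ≤ ∑ j, F j := Finset.sum_le_sum_of_subset_of_nonneg (Finset.subset_univ _)
            fun _ _ _ ↦ sumSq_nonneg _
    have h2 : 128 * ((n / 4 : ℕ) : ℝ) ^ 2 * n * k ≤ 128 * ((n : ℝ) / 4) ^ 2 * n * n := by
      gcongr
      linarith
    have h3 : (J.card : ℝ) * n ^ 4 ≤ (8 * 200 ^ 4) * n ^ 4 := by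
      have h4 : (J.card : ℝ) * n ^ 4 = 200 ^ 4 * (J.card * ((n : ℝ) / 200) ^ 4) := by ring
      have h5 : 128 * ((n : ℝ) / 4) ^ 2 * n * n = 8 * n ^ 4 := by ring
      rw [h4]
      linarith
    have h6 : (J.card : ℝ) ≤ 8 * 200 ^ 4 := le_of_mul_le_mul_right h3 (by positivity)
    have h7 : 4 * (J.card : ℝ) ≤ n := by linarith
    exact_mod_cast h7
  have hIJ : Disjoint I J := by
    rw [Finset.disjoint_left]
    intro j hj hj'
    exact (Finset.mem_filter.1 hj').2.1 hj
  -- The exceptional parts come while at most `n/4 + n/4` parts are used, so the greedy choice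
  -- suffices.
  obtain ⟨τ₁, hτ₁, hc₁⟩ := hc.exists_extension hσ J hIJ fun j hj K τ' _ hK hjK _ ↦
    exists_perm_not_conflict_of_card_le σ τ' K j (by
      have h1 := Finset.card_le_card hK
      rw [Finset.card_union_of_disjoint hIJ] at h1
      omega)
  obtain ⟨τ₂, -, hc₂⟩ := hc₁.exists_extension hσ (I ∪ J)ᶜ disjoint_compl_right
    fun j hj K τ' hIK _ hjK hτ' ↦ by
      have hjJ : j ∉ I ∪ J := Finset.mem_compl.1 hj
      rw [Finset.mem_union, not_or] at hjJ
      have hFj : F j ≤ ((n : ℝ) / 200) ^ 4 := by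
        by_contra! hlt
        exact hjJ.2 (Finset.mem_filter.2 ⟨Finset.mem_univ _, hjJ.1, hlt⟩)
      -- Extensions never change the labels on `I`, so quasirandomness persists.
      have hdisc : discrepancy σ τ' I j (E j) = discrepancy σ τ I j (E j) := by
        simp only [discrepancy]
        congr 1
        refine Finset.sum_congr rfl fun i hi ↦ ?_
        rw [hτ' i (Finset.mem_union_left _ hi), hτ₁ i hi]
      have hcard : K.card + 1 ≤ k := by
        rw [← Finset.card_insert_of_notMem hjK]
        exact Finset.card_le_univ _
      exact exists_perm_not_conflict_of_quasirandom σ τ' I K (Finset.subset_union_left.trans hIK)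
        j (E j) (hE' j) (by rw [hdisc]; exact hFj) (by omega) (by omega) (by omega)
  exact ⟨τ₂, by rwa [Finset.union_compl] at hc₂⟩

/-! ### From graphs to permutations -/

/-- A partial matching of a finite set with itself extends to a permutation. -/
theorem exists_perm_extending {α : Type*} [Finite α] (R : α → α → Prop)
    (h1 : ∀ a b b', R a b → R a b' → b = b') (h2 : ∀ a a' b, R a b → R a' b → a = a') :
    ∃ π : Equiv.Perm α, ∀ a b, R a b → π a = b := by
  classical
  choose f hf using fun x : {a // ∃ b, R a b} ↦ x.2
  choose g hg using fun y : {b // ∃ a, R a b} ↦ y.2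
  let e : {a // ∃ b, R a b} ≃ {b // ∃ a, R a b} :=
    { toFun := fun x ↦ ⟨f x, x.1, hf x⟩
      invFun := fun y ↦ ⟨g y, y.1, hg y⟩
      left_inv := fun x ↦ Subtype.ext (h2 _ _ _ (hg _) (hf x))
      right_inv := fun y ↦ Subtype.ext (h1 _ _ _ (hf _) (hg y)) }
  refine ⟨e.extendSubtype, fun a b hab ↦ ?_⟩
  rw [e.extendSubtype_apply_of_mem a ⟨b, hab⟩]
  exact h1 _ _ _ (hf ⟨a, b, hab⟩) hab

theorem IsKNOneGraph.hasIndepTransversalFactor {V : Type*} {k n : ℕ} {G : SimpleGraph V}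
    {part : V → Fin k} (h : IsKNOneGraph G part n) (hn : 10 ^ 11 ≤ n)
    (hk : 178 * k ≤ 100 * n + 100) : HasIndepTransversalFactor G part := by
  have he (i : Fin k) : Nonempty ({v : V // part v = i} ≃ Fin n) := by
    have h1 : Nat.card {v : V // part v = i} = n := by
      have h2 := h.encard_part i
      change Set.ncard {v : V | part v = i} = n
      rw [Set.ncard, h2]; rfl
    have : Finite {v : V // part v = i} := Nat.finite_of_card_ne_zero (by omega)
    exact ⟨Finite.equivFinOfCardEq h1⟩
  let e (i : Fin k) := (he i).some
  have hperm (i j : Fin k) : ∃ π : Equiv.Perm (Fin n), ∀ a b,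
      G.Adj ((e i).symm a).1 ((e j).symm b).1 → π a = b := by
    refine exists_perm_extending _ (fun a b b' hb hb' ↦ ?_) fun a a' b ha ha' ↦ ?_
    · have := h.matching _ _ _ hb hb' (((e j).symm b).2.trans ((e j).symm b').2.symm)
      exact (e j).symm.injective (Subtype.ext this)
    · have := h.matching _ _ _ ha.symm ha'.symm (((e i).symm a).2.trans ((e i).symm a').2.symm)
      exact (e i).symm.injective (Subtype.ext this)
  choose c hc using hperm
  -- The extensions for `(i, j)` and `(j, i)` were chosen independently; using only `i < j` and
  -- inverting restores symmetry.
  let σ : Fin k → Fin k → Equiv.Perm (Fin n) := fun i j ↦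
    if i < j then c i j else if j < i then (c j i)⁻¹ else 1
  have hσ (i j : Fin k) : σ j i = (σ i j)⁻¹ := by
    rcases lt_trichotomy i j with hij | rfl | hij
    · simp [σ, hij, hij.not_gt]
    · simp [σ]
    · simp [σ, hij, hij.not_gt]
  have hadj (i j : Fin k) (hij : i ≠ j) (a b : Fin n)
      (hG : G.Adj ((e i).symm a).1 ((e j).symm b).1) : σ i j a = b := by
    rcases lt_or_gt_of_ne hij with hlt | hlt
    · simpa [σ, hlt] using hc i j a b hG
    · simp only [σ, hlt, hlt.not_gt, if_true, if_false]
      rw [Equiv.Perm.inv_eq_iff_eq]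
      exact (hc j i b a hG.symm).symm
  obtain ⟨τ, hτ⟩ := exists_compatible σ hσ (by simpa using hn) (by simpa using hk)
  let x (t : Fin n) (i : Fin k) : V := ((e i).symm (τ i t)).1
  have hx (t : Fin n) (i : Fin k) : part (x t i) = i := ((e i).symm (τ i t)).2
  have hxinj (t t' : Fin n) (i j : Fin k) (hxx : x t i = x t' j) : t = t' := by
    obtain rfl : i = j := by rw [← hx t i, hxx, hx]
    exact (τ i).injective ((e i).symm.injective (Subtype.ext hxx))
  refine ⟨Set.range fun t ↦ Set.range (x t), ?_, ?_, ?_⟩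
  · rintro _ ⟨t, rfl⟩
    refine ⟨fun i ↦ ⟨x t i, ⟨⟨i, rfl⟩, hx t i⟩, ?_⟩, ?_⟩
    · rintro _ ⟨⟨j, rfl⟩, rfl⟩
      rw [hx]
    · rintro _ ⟨i, rfl⟩ _ ⟨j, rfl⟩ - hG
      have hij : i ≠ j := by
        have := h.partite _ _ hG
        rwa [hx, hx] at this
      exact hτ i (Finset.mem_univ _) j (Finset.mem_univ _) hij t (hadj i j hij _ _ hG)
  · rintro _ ⟨t, rfl⟩ _ ⟨t', rfl⟩ hne
    refine Set.disjoint_left.2 ?_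
    rintro _ ⟨i, rfl⟩ ⟨j, hj⟩
    exact hne (by rw [hxinj _ _ _ _ hj])
  · refine Set.eq_univ_of_forall fun v ↦ ?_
    refine ⟨_, ⟨(τ (part v)).symm (e (part v) ⟨v, rfl⟩), rfl⟩, part v, ?_⟩
    simp [x]

/-- For all sufficiently large `k`, the number `f(k)` is well defined (the least element of the set
of thresholds exists and is `f(k)`), and `f(k) ≤ 1.78 k`. -/
theorem theorem1 :
    ∃ k₀ : ℕ, ∀ k : ℕ, k₀ ≤ k →
      IsLeast (factorThresholds k) (leastFactorThreshold k) ∧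
        (leastFactorThreshold k : ℝ) ≤ 1.78 * (k : ℝ) := by
  refine ⟨10 ^ 11, fun k hk ↦ ?_⟩
  -- The division rounds down; the `+ 100` in the hypothesis `178 * k ≤ 100 * n + 100` absorbs this.
  have hmem : 178 * k / 100 ∈ factorThresholds k := fun n hn V G part h ↦
    h.hasIndepTransversalFactor (by omega) (by omega)
  refine ⟨⟨Nat.sInf_mem ⟨_, hmem⟩, fun _ h ↦ Nat.sInf_le h⟩, ?_⟩
  have h1 : leastFactorThreshold k ≤ 178 * k / 100 := Nat.sInf_le hmem
  have h2 : 100 * leastFactorThreshold k ≤ 178 * k := by omega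
  have h3 : 100 * (leastFactorThreshold k : ℝ) ≤ 178 * k := by exact_mod_cast h2
  linarith
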